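/- **GroupSort networks.** Let $\|\cdot\|$ be the Euclidean norm and $\|\cdot\|_\infty$ the maximum norm. For $w$ even, let $\sigma_2:\mathbb{R}^{w}\to\mathbb{R}^{w}$ split the coordinates into $w/2$ groups of two and sort each group in decreasing order. A GroupSort network of depth $l\ge 1$ from $\mathbb{R}^d$ to $\mathbb{R}$ is a function $N=h_l\circ\dots\circ h_1$ with $h_1(x)=W_1x+b_1$ and $h_i(z)=W_i\sigma_2(z)+b_i$ for $2\le i\le l$, where the hidden layers $h_1,\dots,h_{l-1}$ have positive even widths $w_1,\dots,w_{l-1}$ and $h_l$ has width $1$; its size is $s=\sum_{i=1}^{l-1}w_i$. For $C>0$ let $\mathcal{N}^1_C(l,s)$ be the class of such networks of depth $l$ and size $s$ with $$\sup_{\|x\|=1}\|W_1x\|_\infty\le 1,\qquad \sup_{\|x\|_\infty=1}\|W_ix\|_\infty\le 1\ (2\le i\le l),\qquad \|b_i\|_\infty\le C\ (1\le i\le l).$$ **Theorem.** For every $R$ there is a constant $A>0$, depending only on $R$, with the following property. Let $d\ge 1$, let $\Omega\subset\mathbb{R}^d$ be nonempty and compact with $\sup_{x\in\Omega}\|x\|\le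 R$, let $K_{\mathcal F}>0$, and let $\mathcal F$ be a class of $1$-Lipschitz functions $f:\Omega\to\mathbb{R}$ with $\sup_{f\in\mathcal F}\|f\|_\infty\le K_{\mathcal F}$. Let $\epsilon>0$ and $C:=K_{\mathcal F}+\sqrt d\,\bigl(\sup_{x\in\Omega}\|x\|+1\bigr)+\epsilon$. Then there are $l$ and $s$ such that for every $f\in\mathcal F$ there is a network $N\in\mathcal{N}^1_C(l,s)$ with $$\sup_{x\in\Omega}|N(x)-f(x)|\le\epsilon,$$ and, if $\epsilon\le\sqrt d$, these satisfy $$l\le A\,d^2\log_2\!\Bigl(\frac{2\sqrt d}{\epsilon}\Bigr),\qquad s\le A\Bigl(\frac{2\sqrt d}{\epsilon}\Bigr)^{d^2}.$$ -/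

import Mathlib

noncomputable section

namespace GroupSort

/-- The GroupSort activation with grouping size `2`. The `2 * k` coordinates of a pre-activation are
indexed by `Fin k × Fin 2` (group, position in the group), and each group is sorted in decreasing
order. -/
def groupSort {k : ℕ} (z : Fin k × Fin 2 → ℝ) : Fin k × Fin 2 → ℝ := fun i =>
  if i.2 = 0 then max (z (i.1, 0)) (z (i.1, 1)) else min (z (i.1, 0)) (z (i.1, 1))

/-- `‖W‖_∞ = sup {‖W x‖_∞ : ‖x‖_∞ = 1}`; the norm of a function type is the maximum norm. -/
def normInf {m n : Type} [Fintype m] [Fintype n] (W : Matrix m n ℝ) : ℝ :=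
  sSup ((fun x : n → ℝ => ‖W.mulVec x‖) '' {x | ‖x‖ = 1})

/-- `‖W‖_{2,∞} = sup {‖W x‖_∞ : ‖x‖ = 1}`, where `‖x‖` is the Euclidean norm. -/
def normTwoInf {m n : Type} [Fintype m] [Fintype n] (W : Matrix m n ℝ) : ℝ :=
  sSup ((fun x : EuclideanSpace ℝ n => ‖W.mulVec x.ofLp‖) '' {x | ‖x‖ = 1})

/-- The weights and offsets of the layers that follow a hidden layer of width `2 * k`, in a network
with output dimension `p`: either the output layer, or a further hidden layer of width `2 * k'`
and the layers after it. -/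
inductive Tail (p : ℕ) : ℕ → Type
  | output {k : ℕ} (W : Matrix (Fin p) (Fin k × Fin 2) ℝ) (b : Fin p → ℝ) : Tail p k
  | hidden {k : ℕ} (k' : ℕ) (W : Matrix (Fin k' × Fin 2) (Fin k × Fin 2) ℝ)
      (b : Fin k' × Fin 2 → ℝ) (T : Tail p k') : Tail p k

namespace Tail

/-- The number of layers. -/
def depth {p : ℕ} : {k : ℕ} → Tail p k → ℕ
  | _, output _ _ => 1
  | _, hidden _ _ _ T => T.depth + 1

/-- The sum of the widths of the hidden layers. -/
def size {p : ℕ} : {k : ℕ} → Tail p k → ℕ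
  | _, output _ _ => 0
  | _, hidden k' _ _ T => 2 * k' + T.size

/-- The function of the previous pre-activation; each layer is `z ↦ W σ₂(z) + b`. -/
def eval {p : ℕ} : {k : ℕ} → Tail p k → (Fin k × Fin 2 → ℝ) → (Fin p → ℝ)
  | _, output W b, z => W.mulVec (groupSort z) + b
  | _, hidden _ W b T, z => T.eval (W.mulVec (groupSort z) + b)

/-- All widths are positive, all weight matrices satisfy `‖W‖_∞ ≤ 1`, all offsets satisfy
`‖b‖_∞ ≤ C`. -/
def Admissible {p : ℕ} (C : ℝ) : {k : ℕ} → Tail p k → Prop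
  | _, output W b => normInf W ≤ 1 ∧ ‖b‖ ≤ C
  | _, hidden k' W b T => 0 < k' ∧ normInf W ≤ 1 ∧ ‖b‖ ≤ C ∧ T.Admissible C

end Tail

/-- The weights and offsets of a GroupSort feed-forward network from `ℝ^d` to `ℝ^p`: a single affine
layer (depth one), or a first hidden layer of width `2 * k` and the layers after it. -/
inductive Network (d p : ℕ) : Type
  | single (W : Matrix (Fin p) (Fin d) ℝ) (b : Fin p → ℝ) : Network d p
  | layers (k : ℕ) (W : Matrix (Fin k × Fin 2) (Fin d) ℝ) (b : Fin k × Fin 2 → ℝ)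
      (T : Tail p k) : Network d p

namespace Network

/-- The number `l` of layers. -/
def depth {d p : ℕ} : Network d p → ℕ
  | single _ _ => 1
  | layers _ _ _ T => T.depth + 1

/-- The sum `w₁ + ⋯ + w_{l-1}` of the widths of the hidden layers. -/
def size {d p : ℕ} : Network d p → ℕ
  | single _ _ => 0
  | layers k _ _ T => 2 * k + T.size

/-- The function computed by the network; the first layer is `x ↦ W₁ x + b₁`. -/
def eval {d p : ℕ} : Network d p → EuclideanSpace ℝ (Fin d) → (Fin p → ℝ)
  | single W b, x => W.mulVec x.ofLp + b
  | layers _ W b T, x => T.eval (W.mulVec x.ofLp + b)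

/-- The constraint on the parameters with the constant `C`: `‖W₁‖_{2,∞} ≤ 1`, `‖W_i‖_∞ ≤ 1` for
`i ≥ 2`, and `‖b_i‖_∞ ≤ C` for all `i`. The widths are positive. -/
def Admissible {d p : ℕ} (C : ℝ) : Network d p → Prop
  | single W b => normTwoInf W ≤ 1 ∧ ‖b‖ ≤ C
  | layers k W b T => 0 < k ∧ normTwoInf W ≤ 1 ∧ ‖b‖ ≤ C ∧ T.Admissible C

end Network

/-- The class of functions computed by GroupSort networks from `ℝ^d` to `ℝ^p` of depth `l` and size
`s` that satisfy the constraint with the constant `C`. -/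
def networkClass (d p : ℕ) (C : ℝ) (l s : ℕ) : Set (EuclideanSpace ℝ (Fin d) → (Fin p → ℝ)) :=
  {g | ∃ N : Network d p, N.depth = l ∧ N.size = s ∧ N.Admissible C ∧ N.eval = g}

end GroupSort

end

namespace GroupSort

/-! On an ε/2-net (y_i) of Ω, a 1-Lipschitz f is approximated by a maximum over i of minima over j
of affine functions, the piece (i, j) interpolating f at y_i and y_j with slope of norm at most 1.
If x is near y_k, all pieces (k, j) are close to f(y_k) at x, which bounds the max-min below; every
minimum contains a piece (i, k), which bounds it above (`abs_sub_le_of_interpolation`).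

The pieces form the first layer; knockout rounds, whose weights only select coordinates, compute the
max-min (`exists_network_max_min`).

With t = 2√d/ε, a grid (`exists_net`) has n = O(t)^d points for t ≥ 2. The n² pieces fit the size
bound t^(d²) only for d ≥ 2. For d = 1, the cones f(y_i) - |x - y_i|, each a minimum of two affine
functions, need only 2n pieces (`abs_sub_le_of_cones`). -/

theorem mulVec_one_submatrix {m n : Type} [Fintype n] [DecidableEq n] (g : m → n) (v : n → ℝ) :
    ((1 : Matrix n n ℝ).submatrix g id).mulVec v = v ∘ g := by
  ext i
  simp [Matrix.mulVec, dotProduct, Matrix.one_apply]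

theorem normInf_one_submatrix_le {m n : Type} [Fintype m] [Fintype n] [DecidableEq n] (g : m → n) :
    normInf ((1 : Matrix n n ℝ).submatrix g id) ≤ 1 := by
  refine Real.sSup_le ?_ zero_le_one
  rintro _ ⟨x, hx, rfl⟩
  have hx : ‖x‖ = 1 := hx
  simp only [mulVec_one_submatrix]
  refine (pi_norm_le_iff_of_nonneg zero_le_one).2 fun i => ?_
  rw [← hx]
  exact norm_le_pi_norm x (g i)

theorem mulVec_of_rows {m n : Type} [Fintype n] (u : m → EuclideanSpace ℝ n)
    (x : EuclideanSpace ℝ n) (i : m) :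
    (Matrix.of fun i j => u i j).mulVec x.ofLp i = inner ℝ (u i) x := by
  simp [Matrix.mulVec, dotProduct, PiLp.inner_apply, mul_comm]

theorem normTwoInf_le_one {m n : Type} [Fintype m] [Fintype n] (u : m → EuclideanSpace ℝ n)
    (hu : ∀ i, ‖u i‖ ≤ 1) : normTwoInf (Matrix.of fun i j => u i j) ≤ 1 := by
  refine Real.sSup_le ?_ zero_le_one
  rintro _ ⟨x, hx, rfl⟩
  have hx : ‖x‖ = 1 := hx
  refine (pi_norm_le_iff_of_nonneg zero_le_one).2 fun i => ?_
  simp only [mulVec_of_rows]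
  calc ‖inner ℝ (u i) x‖ ≤ ‖u i‖ * ‖x‖ := norm_inner_le_norm _ _
    _ ≤ 1 := by rw [hx, mul_one]; exact hu i

/-! ### Knockout tournaments for maxima and minima. -/

namespace Tail

/-- The equivalence that splits `2 ^ (p + 1)` indices into pairs. -/
def pairEquiv (p : ℕ) : Fin (2 ^ p) × Fin 2 ≃ Fin (2 ^ (p + 1)) :=
  finProdFinEquiv.trans (finCongr (pow_succ 2 p).symm)

/-- Precede `T` by a layer that keeps from each group the maximum (`a = 0`) or the minimum
(`a = 1`), the groups being paired by `e`. -/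
def tournament {p k k' : ℕ} (e : Fin k × Fin 2 ≃ Fin k') (a : Fin 2) (T : Tail p k) : Tail p k' :=
  hidden k ((1 : Matrix (Fin k' × Fin 2) (Fin k' × Fin 2) ℝ).submatrix
    (fun s => (e s, a)) id) 0 T

section Tournament

variable {p k k' : ℕ} (e : Fin k × Fin 2 ≃ Fin k') (a : Fin 2) (T : Tail p k)

theorem tournament_depth : (T.tournament e a).depth = T.depth + 1 := rfl

theorem tournament_size : (T.tournament e a).size = 2 * k + T.size := rfl

theorem tournament_eval (z : Fin k' × Fin 2 → ℝ) :
    (T.tournament e a).eval z = T.eval fun s => groupSort z (e s, a) := by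
  simp only [tournament, eval, mulVec_one_submatrix, add_zero]
  rfl

variable {T} in
theorem tournament_admissible {C : ℝ} (hC : 0 ≤ C) (hk : 0 < k) (hT : T.Admissible C) :
    (T.tournament e a).Admissible C :=
  ⟨hk, normInf_one_submatrix_le _, by simpa using hC, hT⟩

end Tournament

theorem exists_prod_fin_two_iff_le_max {ι : Type*} (z : ι × Fin 2 → ℝ) (c : ℝ) :
    (∃ s, c ≤ z s) ↔ ∃ i, c ≤ max (z (i, 0)) (z (i, 1)) := by
  simp only [Prod.exists, Fin.exists_fin_two, le_max_iff]

/-- A network of `p + 1` layers that computes the maximum of `2 ^ (p + 1)` numbers. -/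
theorem exists_max (p : ℕ) : ∃ T : Tail 1 (2 ^ p), T.depth = p + 1 ∧ T.size + 2 = 2 * 2 ^ p ∧
    (∀ C : ℝ, 0 ≤ C → T.Admissible C) ∧ ∀ z c, c ≤ T.eval z 0 ↔ ∃ s, c ≤ z s := by
  induction p with
  | zero =>
    refine ⟨output ((1 : Matrix (Fin (2 ^ 0) × Fin 2) (Fin (2 ^ 0) × Fin 2) ℝ).submatrix
      (fun _ : Fin 1 => (0, 0)) id) 0, rfl, rfl,
      fun C hC => ⟨normInf_one_submatrix_le _, by simpa using hC⟩, fun z c => ?_⟩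
    rw [exists_prod_fin_two_iff_le_max]
    simp only [eval, mulVec_one_submatrix, add_zero]
    exact (Unique.exists_iff (α := Fin 1) (p := fun i => c ≤ max (z (i, 0)) (z (i, 1)))).symm
  | succ p ih =>
    obtain ⟨T, hd, hs, hT, he⟩ := ih
    refine ⟨T.tournament (pairEquiv p) 0, ?_, ?_,
      fun C hC => tournament_admissible _ _ hC (by positivity) (hT C hC), fun z c => ?_⟩
    · rw [tournament_depth, hd]
    · rw [tournament_size, pow_succ]
      omega
    · simp only [tournament_eval, he, groupSort, if_true]
      rw [exists_prod_fin_two_iff_le_max (ι := Fin (2 ^ (p + 1))), (pairEquiv p).surjective.exists]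

/-- A network of `p + q + 2` layers that computes the maximum over `2 ^ (p + 1)` blocks of the
minimum over the `2 ^ (q + 1)` entries of the block. -/
theorem exists_max_min (p q : ℕ) : ∃ T : Tail 1 (2 ^ (p + 1 + q)), T.depth = p + q + 2 ∧
    T.size + 2 = 2 * 2 ^ (p + 1 + q) ∧ (∀ C : ℝ, 0 ≤ C → T.Admissible C) ∧
    ∃ e : Fin (2 ^ (p + 1)) × Fin (2 ^ (q + 1)) ≃ Fin (2 ^ (p + 1 + q)) × Fin 2,
      ∀ z c, c ≤ T.eval z 0 ↔ ∃ i, ∀ j, c ≤ z (e (i, j)) := by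
  induction q with
  | zero =>
    obtain ⟨T, hd, hs, hT, he⟩ := exists_max p
    refine ⟨T.tournament (pairEquiv p) 1, ?_, ?_,
      fun C hC => tournament_admissible _ _ hC (by positivity) (hT C hC),
      Equiv.refl _, fun z c => ?_⟩
    · rw [tournament_depth, hd]
    · rw [tournament_size, add_zero, pow_succ]
      omega
    · simp only [tournament_eval, he, groupSort, one_ne_zero, if_false, le_min_iff]
      rw [(pairEquiv p).surjective.exists]
      exact exists_congr fun s =>
        (Fin.forall_fin_two (p := fun a => c ≤ z (pairEquiv p s, a))).symm
  | succ q ih =>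
    obtain ⟨T, hd, hs, hT, e, he⟩ := ih
    refine ⟨T.tournament (pairEquiv (p + 1 + q)) 1, ?_, ?_,
      fun C hC => tournament_admissible _ _ hC (by positivity) (hT C hC),
      -- An entry index splits into a pair and a position: the old wiring sends block and pair to a
      -- group, and the position is kept inside that group.
      ((Equiv.refl _).prodCongr (pairEquiv (q + 1)).symm).trans <|
        (Equiv.prodAssoc _ _ _).symm.trans <|
        (e.trans (pairEquiv (p + 1 + q))).prodCongr (Equiv.refl _), fun z c => ?_⟩
    · rw [tournament_depth, hd]
      ring
    · rw [tournament_size, ← add_assoc, pow_succ _ (p + 1 + q)]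
      omega
    · simp only [tournament_eval, he, groupSort, one_ne_zero, if_false, le_min_iff]
      refine exists_congr fun i => ?_
      rw [(pairEquiv (q + 1)).surjective.forall, Prod.forall]
      refine forall_congr' fun j => (Fin.forall_fin_two
        (p := fun a => c ≤ z (pairEquiv (p + 1 + q) (e (i, j)), a))).symm.trans
        (forall_congr' fun k => ?_)
      simp

end Tail

theorem exists_surjective_fin {I : Type} [Fintype I] [Nonempty I] {n : ℕ}
    (h : Fintype.card I ≤ n) : ∃ α : Fin n → I, Function.Surjective α := by
  obtain ⟨α⟩ := Function.Embedding.nonempty_of_card_le (α := I) (β := Fin n) (by simpa using h)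
  exact ⟨_, Function.invFun_surjective α.injective⟩

/-- Maxima of minima of affine functions with slopes of norm at most `1` are GroupSort networks. -/
theorem exists_network_max_min {d : ℕ} {C : ℝ} (hC : 0 ≤ C) (p q : ℕ) {I J : Type} [Fintype I]
    [Fintype J] [Nonempty I] [Nonempty J] (hI : Fintype.card I ≤ 2 ^ (p + 1))
    (hJ : Fintype.card J ≤ 2 ^ (q + 1)) (u : I → J → EuclideanSpace ℝ (Fin d)) (b : I → J → ℝ)
    (hu : ∀ i j, ‖u i j‖ ≤ 1) (hb : ∀ i j, |b i j| ≤ C) :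
    ∃ N ∈ networkClass d 1 C (p + q + 3) (4 * 2 ^ (p + 1 + q) - 2),
      ∀ x c, c ≤ N x 0 ↔ ∃ i, ∀ j, c ≤ inner ℝ (u i j) x + b i j := by
  obtain ⟨T, hd, hs, hT, e, he⟩ := Tail.exists_max_min p q
  -- Padding to powers of two repeats pieces, which changes no maximum or minimum.
  obtain ⟨α, hα⟩ : ∃ α : Fin (2 ^ (p + 1)) → I, Function.Surjective α :=
    exists_surjective_fin hI
  obtain ⟨β, hβ⟩ : ∃ β : Fin (2 ^ (q + 1)) → J, Function.Surjective β := exists_surjective_fin hJ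
  let γ : Fin (2 ^ (p + 1 + q)) × Fin 2 → I × J := fun s => Prod.map α β (e.symm s)
  refine ⟨_, ⟨Network.layers (2 ^ (p + 1 + q))
    (Matrix.of fun s j => u (γ s).1 (γ s).2 j) (fun s => b (γ s).1 (γ s).2) T, ?_, ?_,
      ⟨by positivity, normTwoInf_le_one _ fun s => hu _ _,
        (pi_norm_le_iff_of_nonneg hC).2 fun s => hb _ _, hT C hC⟩, rfl⟩, fun x c => ?_⟩
  · simp only [Network.depth, hd]
  · simp only [Network.size]
    omega
  · simp only [Network.eval, he, Pi.add_apply, mulVec_of_rows (fun s => u (γ s).1 (γ s).2)]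
    simp only [γ, Equiv.symm_apply_apply, Prod.map_apply]
    rw [hα.exists]
    exact exists_congr fun i => (hβ.forall (p := fun j => c ≤ inner ℝ (u (α i) j) x + b (α i) j)).symm

/-! ### Finite nets. -/

/-- A grid decomposition of the ball of radius `R` in `ℝ^d` into cells of diameter at most
`√d / t`. -/
theorem exists_net {d : ℕ} {Ω : Set (EuclideanSpace ℝ (Fin d))} (hΩ : Ω.Nonempty) {R t : ℝ}
    (hR : ∀ x ∈ Ω, ‖x‖ ≤ R) (ht : 0 < t) :
    ∃ y : (Fin d → Fin (2 * ⌈R * t⌉₊ + 1)) → Ω, ∀ x : Ω, ∃ i,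
      ‖(x : EuclideanSpace ℝ (Fin d)) - y i‖ ≤ √d / t := by
  classical
  set M := ⌈R * t⌉₊ with hM
  have hbd : ∀ (x : Ω) (k : Fin d), 0 ≤ ⌊(x : EuclideanSpace ℝ (Fin d)) k * t⌋ + M ∧
      ⌊(x : EuclideanSpace ℝ (Fin d)) k * t⌋ + M < 2 * M + 1 := by
    intro x k
    have h1 : |(x : EuclideanSpace ℝ (Fin d)) k| ≤ R :=
      (PiLp.norm_apply_le (x : EuclideanSpace ℝ (Fin d)) k).trans (hR x x.2)
    have h2 : |(x : EuclideanSpace ℝ (Fin d)) k * t| ≤ M := by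
      rw [abs_mul, abs_of_pos ht]
      exact (mul_le_mul_of_nonneg_right h1 ht.le).trans (Nat.le_ceil _)
    obtain ⟨h3, h4⟩ := abs_le.1 h2
    have h5 : -(M : ℤ) ≤ ⌊(x : EuclideanSpace ℝ (Fin d)) k * t⌋ :=
      Int.le_floor.2 (by push_cast; exact h3)
    have h6 : ⌊(x : EuclideanSpace ℝ (Fin d)) k * t⌋ ≤ M := by
      rw [← Int.cast_le (R := ℝ)]
      exact (Int.floor_le _).trans (by simpa using h4)
    omega
  let g : Ω → Fin d → Fin (2 * M + 1) := fun x k =>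
    ⟨(⌊(x : EuclideanSpace ℝ (Fin d)) k * t⌋ + M).toNat, by have := hbd x k; omega⟩
  have : Nonempty Ω := hΩ.to_subtype
  -- One point of Ω is chosen in each occupied cell; empty cells receive an arbitrary point of Ω.
  refine ⟨Function.invFun g, fun x => ⟨g x, ?_⟩⟩
  set y := Function.invFun g (g x)
  have hy : g y = g x := Function.invFun_eq ⟨x, rfl⟩
  have hk : ∀ k, |((x : EuclideanSpace ℝ (Fin d)) - y) k| ≤ 1 / t := by
    intro k
    have h1 := congrArg Fin.val (congrFun hy k)
    have h2 : ⌊(y : EuclideanSpace ℝ (Fin d)) k * t⌋ = ⌊(x : EuclideanSpace ℝ (Fin d)) k * t⌋ := by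
      have := hbd x k
      have := hbd y k
      simp only [g] at h1
      omega
    have h3 := Int.abs_sub_lt_one_of_floor_eq_floor h2.symm
    rw [← sub_mul, abs_mul, abs_of_pos ht] at h3
    rw [le_div_iff₀ ht]
    exact h3.le
  rw [EuclideanSpace.norm_eq, div_eq_mul_one_div, ← Real.sqrt_sq (one_div_nonneg.2 ht.le),
    ← Real.sqrt_mul (Nat.cast_nonneg d)]
  refine Real.sqrt_le_sqrt ?_
  calc ∑ k, ‖((x : EuclideanSpace ℝ (Fin d)) - y) k‖ ^ 2 ≤ ∑ _k : Fin d, (1 / t) ^ 2 :=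
        Finset.sum_le_sum fun k _ => pow_le_pow_left₀ (norm_nonneg _) (hk k) 2
    _ = d * (1 / t) ^ 2 := by simp

/-! ### Approximation by max-min of affine functions. -/

section Approximation

variable {E : Type*} [NormedAddCommGroup E] [InnerProductSpace ℝ E] {Ω : Set E} {f : Ω → ℝ}

/-- The slope of the affine function that interpolates `f` at `x` and `y` and is constant on the
orthogonal complement of `y - x`. -/
noncomputable def interpolationSlope (f : Ω → ℝ) (x y : Ω) : E :=
  ((f y - f x) / ‖(y : E) - x‖ ^ 2) • ((y : E) - x)

theorem abs_sub_le {E : Type*} [NormedAddCommGroup E] {Ω : Set E} {f : Ω → ℝ}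
    (hf : LipschitzWith 1 f) (x y : Ω) : |f x - f y| ≤ ‖(x : E) - y‖ := by
  have h := hf.dist_le_mul x y
  rwa [NNReal.coe_one, one_mul, Real.dist_eq, Subtype.dist_eq, dist_eq_norm] at h

theorem norm_interpolationSlope_le (hf : LipschitzWith 1 f) (x y : Ω) :
    ‖interpolationSlope f x y‖ ≤ 1 := by
  have h := abs_sub_le hf y x
  rw [interpolationSlope, norm_smul, Real.norm_eq_abs, abs_div, abs_of_nonneg (sq_nonneg ‖_‖)]
  rcases (norm_nonneg ((y : E) - x)).eq_or_lt with h0 | h0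
  · simp [← h0]
  · rw [sq, div_mul_eq_mul_div, mul_div_mul_right _ _ h0.ne']
    exact (div_le_one h0).2 h

theorem inner_interpolationSlope (hf : LipschitzWith 1 f) (x y : Ω) :
    inner ℝ (interpolationSlope f x y) ((y : E) - x) = f y - f x := by
  rw [interpolationSlope, real_inner_smul_left, real_inner_self_eq_norm_sq]
  rcases eq_or_ne ‖(y : E) - x‖ 0 with h0 | h0
  · have h := abs_sub_le hf y x
    rw [h0] at h
    have := abs_nonpos_iff.1 h
    simp [this]
  · field_simp

theorem abs_sub_le_of_interpolation (hf : LipschitzWith 1 f) {I : Type} {y : I → Ω} {δ : ℝ}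
    (hy : ∀ x : Ω, ∃ i, ‖(x : E) - y i‖ ≤ δ) {x : Ω} {v : ℝ}
    (hv : ∀ c, c ≤ v ↔ ∃ i, ∀ j, c ≤ inner ℝ (interpolationSlope f (y i) (y j)) (x : E) +
      (f (y i) - inner ℝ (interpolationSlope f (y i) (y j)) (y i : E))) :
    |v - f x| ≤ 2 * δ := by
  obtain ⟨k, hk⟩ := hy x
  have hfk := abs_le.1 ((abs_sub_le hf x (y k)).trans hk)
  have hu : ∀ i j, |inner ℝ (interpolationSlope f (y i) (y j)) ((x : E) - y k)| ≤ δ := fun i j =>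
    ((abs_real_inner_le_norm _ _).trans (mul_le_of_le_one_left (norm_nonneg _)
      (norm_interpolationSlope_le hf _ _))).trans hk
  refine abs_le.2 ⟨?_, ?_⟩
  · have : f x - 2 * δ ≤ v := (hv _).2 ⟨k, fun j => by
      have h := (abs_le.1 (hu k j)).1
      rw [inner_sub_right] at h
      linarith [hfk.2]⟩
    linarith
  · obtain ⟨i, hi⟩ := (hv v).1 le_rfl
    have h1 := hi k
    have h2 := (abs_le.1 (hu i k)).2
    have h3 := inner_interpolationSlope hf (y i) (y k)
    rw [inner_sub_right] at h2 h3
    linarith [hfk.1]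

/-- The minimum over `j` is the cone f(y_i) - ‖x - y_i‖. Each cone lies below f by the Lipschitz
bound, and the cone at a nearby net point loses at most 2δ. -/
theorem abs_sub_le_of_cones (hf : LipschitzWith 1 f) {I : Type} {y : I → Ω} {δ : ℝ}
    (hy : ∀ x : Ω, ∃ i, ‖(x : E) - y i‖ ≤ δ) {e : E} (he : ∀ z : E, |inner ℝ e z| = ‖z‖)
    {x : Ω} {v : ℝ}
    (hv : ∀ c, c ≤ v ↔ ∃ i, ∀ j : Fin 2, c ≤ inner ℝ (![e, -e] j) (x : E) +
      (f (y i) - inner ℝ (![e, -e] j) (y i : E))) :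
    |v - f x| ≤ 2 * δ := by
  simp only [Fin.forall_fin_two, Matrix.cons_val_zero, Matrix.cons_val_one, inner_neg_left] at hv
  have key : ∀ i, |inner ℝ e (x : E) - inner ℝ e (y i : E)| = ‖(x : E) - y i‖ := fun i => by
    rw [← inner_sub_right, he]
  refine abs_le.2 ⟨?_, ?_⟩
  · obtain ⟨k, hk⟩ := hy x
    have hfk := abs_le.1 ((abs_sub_le hf x (y k)).trans hk)
    have h := abs_le.1 ((key k).le.trans hk)
    have : f x - 2 * δ ≤ v := (hv _).2 ⟨k, by linarith [hfk.2, h.1], by linarith [hfk.2, h.2]⟩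
    linarith
  · obtain ⟨i, h1, h2⟩ := (hv v).1 le_rfl
    have hfi := (abs_le.1 (abs_sub_le hf x (y i))).1
    have h0 : 0 ≤ δ := (norm_nonneg _).trans (hy x).choose_spec
    rw [← key i] at hfi
    rcases abs_cases (inner ℝ e (x : E) - inner ℝ e (y i : E)) with ⟨h, -⟩ | ⟨h, -⟩ <;> linarith

end Approximation

/-! ### Size and depth estimates. -/

theorem two_pow_log_add_one_le {n : ℕ} (hn : n ≠ 0) : 2 ^ (Nat.log 2 n + 1) ≤ 2 * n := by
  have := Nat.pow_log_le_self 2 hn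
  rw [pow_succ]
  omega

theorem natLog_two_le_logb (n : ℕ) : (Nat.log 2 n : ℝ) ≤ Real.logb 2 n := by
  exact_mod_cast Real.natLog_le_logb n 2

/-- Comparison of the squared size of a grid with the growth rate `t ^ (d ^ 2)`. -/
theorem grid_sq_le {t B : ℝ} {r d : ℕ} (ht : 2 ≤ t) (hB0 : 0 ≤ B) (hB : B ≤ 2 ^ r) (hd : 2 ≤ d) :
    ((B * t) ^ d) ^ 2 ≤ 2 ^ ((r + 1) ^ 2) * t ^ (d ^ 2) := by
  -- The factor 2^(d²) inside t^(d²) absorbs the d-dependence, since 2(r+1)d ≤ (r+1)² + d²; the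
  -- constant then depends on r alone.
  obtain ⟨τ, rfl⟩ : ∃ τ, t = 2 * τ := ⟨t / 2, by ring⟩
  have hτ : 1 ≤ τ := by linarith
  have h1 : B * (2 * τ) ≤ 2 ^ (r + 1) * τ := by
    rw [pow_succ, mul_assoc]
    gcongr
  have h0 : 0 ≤ B * (2 * τ) := by positivity
  calc ((B * (2 * τ)) ^ d) ^ 2 ≤ ((2 ^ (r + 1) * τ) ^ d) ^ 2 := by gcongr
    _ = 2 ^ (2 * ((r + 1) * d)) * τ ^ (2 * d) := by ring
    _ ≤ 2 ^ ((r + 1) ^ 2 + d ^ 2) * τ ^ (d ^ 2) := by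
        gcongr
        · norm_num
        · zify; nlinarith [sq_nonneg ((r : ℤ) + 1 - d)]
        · nlinarith
    _ = 2 ^ ((r + 1) ^ 2) * (2 * τ) ^ (d ^ 2) := by rw [pow_add, mul_pow]; ring

end GroupSort

/-! ### The approximation theorem. -/

theorem theorem1 (R : ℝ) :
    ∃ A : ℝ, 0 < A ∧
      ∀ (d : ℕ), 0 < d →
      ∀ (Ω : Set (EuclideanSpace ℝ (Fin d))), IsCompact Ω → Ω.Nonempty → (∀ x ∈ Ω, ‖x‖ ≤ R) →
      ∀ (K : ℝ), 0 < K →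
      ∀ (F : Set (Ω → ℝ)), (∀ f ∈ F, LipschitzWith 1 f) → (∀ f ∈ F, ∀ x : Ω, |f x| ≤ K) →
      ∀ (ε : ℝ), 0 < ε →
      ∃ l s : ℕ,
        (ε ≤ √(d : ℝ) →
          (l : ℝ) ≤ A * ((d : ℝ) ^ 2 * Real.logb 2 (2 * √(d : ℝ) / ε)) ∧
          (s : ℝ) ≤ A * (2 * √(d : ℝ) / ε) ^ (d ^ 2)) ∧
        ∀ f ∈ F,
          ∃ N ∈ GroupSort.networkClass d 1
              (K + √(d : ℝ) * ((⨆ x : Ω, ‖(x : EuclideanSpace ℝ (Fin d))‖) + 1) + ε) l s,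
            ∀ x : Ω, |N (x : EuclideanSpace ℝ (Fin d)) 0 - f x| ≤ ε := by
  obtain ⟨r, hr⟩ : ∃ r : ℕ, 2 * |R| + 2 ≤ 2 ^ r := by
    obtain ⟨r, hr⟩ := pow_unbounded_of_one_lt (2 * |R| + 2) one_lt_two
    exact ⟨r, hr.le⟩
  -- The summands serve the size for d ≥ 2, the size for d = 1, and the depth 2 log n + 3.
  refine ⟨8 * 2 ^ ((r + 1) ^ 2) + 8 * 2 ^ r + (2 * r + 5), by positivity, ?_⟩
  intro d hd Ω _ hΩ hR K hK F hF hFK ε hε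
  have hd0 : (0 : ℝ) < √d := Real.sqrt_pos.2 (by exact_mod_cast hd)
  have hd1 : (1 : ℝ) ≤ √d := Real.one_le_sqrt.2 (by exact_mod_cast hd)
  set t : ℝ := 2 * √d / ε with ht
  have ht0 : 0 < t := by positivity
  have hmesh : 2 * (√d / t) = ε := by rw [ht]; field_simp
  have hR0 : 0 ≤ R := (norm_nonneg _).trans (hR _ hΩ.some_mem)
  rw [abs_of_nonneg hR0] at hr
  obtain ⟨y, hy⟩ := GroupSort.exists_net hΩ hR ht0
  set C : ℝ := K + √d * ((⨆ x : Ω, ‖(x : EuclideanSpace ℝ (Fin d))‖) + 1) + ε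
  have hS : ∀ x : Ω, ‖(x : EuclideanSpace ℝ (Fin d))‖ ≤
      ⨆ x : Ω, ‖(x : EuclideanSpace ℝ (Fin d))‖ :=
    le_ciSup ⟨R, by rintro _ ⟨x, rfl⟩; exact hR x x.2⟩
  have hKC : ∀ x : Ω, K + ‖(x : EuclideanSpace ℝ (Fin d))‖ ≤ C := fun x => by
    have h0 := (norm_nonneg _).trans (hS x)
    have := hS x
    have : 1 * ((⨆ x : Ω, ‖(x : EuclideanSpace ℝ (Fin d))‖) + 1) ≤
        √d * ((⨆ x : Ω, ‖(x : EuclideanSpace ℝ (Fin d))‖) + 1) := by gcongr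
    linarith
  have hC : 0 ≤ C := (by positivity : (0 : ℝ) ≤ K + ‖(hΩ.some : EuclideanSpace ℝ (Fin d))‖).trans
    (hKC ⟨_, hΩ.some_mem⟩)
  have hbias : ∀ f ∈ F, ∀ (u : EuclideanSpace ℝ (Fin d)) (x : Ω), ‖u‖ ≤ 1 →
      |f x - inner ℝ u (x : EuclideanSpace ℝ (Fin d))| ≤ C := fun f hf u x hu =>
    (abs_sub _ _).trans <| (add_le_add (hFK f hf x) ((abs_real_inner_le_norm _ _).trans
      (mul_le_of_le_one_left (norm_nonneg _) hu))).trans (hKC x)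
  set n : ℕ := Fintype.card (Fin d → Fin (2 * ⌈R * t⌉₊ + 1)) with hn
  have hn0 : n ≠ 0 := Fintype.card_ne_zero
  have hnt : 2 ≤ t → (n : ℝ) ≤ ((2 * R + 2) * t) ^ d := fun ht2 => by
    have h1 := (Nat.ceil_lt_add_one (mul_nonneg hR0 ht0.le)).le
    rw [hn]
    simp only [Fintype.card_fun, Fintype.card_fin]
    push_cast
    gcongr
    -- 2⌈Rt⌉ + 1 ≤ 2Rt + 3 ≤ (2R + 2)t, as t ≥ 2.
    linarith
  have hp : n ≤ 2 ^ (Nat.log 2 n + 1) := (Nat.lt_pow_succ_log_self one_lt_two n).le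
  have hp2 := GroupSort.two_pow_log_add_one_le hn0
  have hlogt : 2 ≤ t → 1 ≤ Real.logb 2 t := fun ht2 => by
    rw [Real.le_logb_iff_rpow_le one_lt_two ht0]
    simpa using ht2
  have hlog : 2 ≤ t → (Nat.log 2 n : ℝ) ≤ d * ((r + 1) * Real.logb 2 t) := fun ht2 => by
    have hl := hlogt ht2
    calc (Nat.log 2 n : ℝ) ≤ Real.logb 2 n := GroupSort.natLog_two_le_logb n
      _ ≤ Real.logb 2 ((2 ^ r * t) ^ d) := by
          refine Real.logb_le_logb_of_le one_lt_two (by positivity) ((hnt ht2).trans ?_)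
          gcongr
      _ = d * (r + Real.logb 2 t) := by
          rw [Real.logb_pow, Real.logb_mul (by positivity) ht0.ne', Real.logb_pow,
            Real.logb_self_eq_one one_lt_two, mul_one]
      _ ≤ d * ((r + 1) * Real.logb 2 t) := by
          gcongr
          nlinarith [(Nat.cast_nonneg r : (0 : ℝ) ≤ r)]
  have ht2 : ε ≤ √d → 2 ≤ t := fun h => by
    rw [ht, le_div_iff₀ hε]
    linarith
  rcases (Nat.succ_le_of_lt hd).eq_or_lt with hd' | hd'
  · obtain rfl : d = 1 := hd'.symm
    refine ⟨Nat.log 2 n + 0 + 3, 4 * 2 ^ (Nat.log 2 n + 1 + 0) - 2, fun h => ?_, fun f hf => ?_⟩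
    · have hL := hlogt (ht2 h)
      have hs : 4 * 2 ^ (Nat.log 2 n + 1 + 0) - 2 ≤ 8 * n := by
        rw [add_zero]
        omega
      have h1 := hlog (ht2 h)
      have h2 := hnt (ht2 h)
      push_cast at h1 ⊢
      rw [pow_one] at h2
      refine ⟨?_, ?_⟩
      · rw [one_pow, one_mul]
        refine le_trans ?_ (mul_le_mul_of_nonneg_right (le_add_of_nonneg_left (by positivity))
          (by positivity))
        nlinarith
      · calc ((4 * 2 ^ (Nat.log 2 n + 1 + 0) - 2 : ℕ) : ℝ) ≤ 8 * n := by exact_mod_cast hs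
          _ ≤ 8 * (2 ^ r * t) := by gcongr; exact h2.trans (by gcongr)
          _ = 8 * 2 ^ r * t ^ (1 ^ 2) := by ring
          _ ≤ _ := by
            refine mul_le_mul_of_nonneg_right ?_ (by positivity)
            linarith [(by positivity : (0 : ℝ) ≤ 8 * 2 ^ ((r + 1) ^ 2)),
              (by positivity : (0 : ℝ) ≤ 2 * r + 5)]
    · let e : EuclideanSpace ℝ (Fin 1) := EuclideanSpace.single 0 1
      have he : ∀ z : EuclideanSpace ℝ (Fin 1), |inner ℝ e z| = ‖z‖ := fun z => by
        simp [e, EuclideanSpace.norm_eq, Real.sqrt_sq_eq_abs, EuclideanSpace.inner_single_left]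
      have he1 : ∀ j, ‖(![e, -e] : Fin 2 → EuclideanSpace ℝ (Fin 1)) j‖ ≤ 1 := by
        simp [Fin.forall_fin_two, e]
      obtain ⟨N, hN, hNe⟩ := GroupSort.exists_network_max_min hC (Nat.log 2 n) 0 hp
        (J := Fin 2) (by simp) (fun _ j => ![e, -e] j)
        (fun i j => f (y i) - inner ℝ (![e, -e] j) (y i : EuclideanSpace ℝ (Fin 1)))
        (fun _ j => he1 j) fun i j => hbias f hf _ _ (he1 j)
      exact ⟨N, hN, fun x =>
        hmesh ▸ GroupSort.abs_sub_le_of_cones (hF f hf) hy he (hNe x)⟩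
  · refine ⟨Nat.log 2 n + Nat.log 2 n + 3, 4 * 2 ^ (Nat.log 2 n + 1 + Nat.log 2 n) - 2,
      fun h => ⟨?_, ?_⟩, fun f hf => ?_⟩
    · have hL := hlogt (ht2 h)
      have h1 := hlog (ht2 h)
      have hd2 : (1 : ℝ) ≤ d := by exact_mod_cast hd
      have hdd : (d : ℝ) ≤ d ^ 2 := by nlinarith
      have hX : 1 ≤ (d : ℝ) ^ 2 * Real.logb 2 t := by nlinarith
      refine le_trans ?_ (mul_le_mul_of_nonneg_right (le_add_of_nonneg_left (by positivity))
        (by positivity))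
      have h3 : (d : ℝ) * ((r + 1) * Real.logb 2 t) ≤ (r + 1) * (d ^ 2 * Real.logb 2 t) := by
        calc (d : ℝ) * ((r + 1) * Real.logb 2 t) ≤ d ^ 2 * ((r + 1) * Real.logb 2 t) := by gcongr
          _ = _ := by ring
      push_cast
      linarith
    · have hs : 4 * 2 ^ (Nat.log 2 n + 1 + Nat.log 2 n) - 2 ≤ 8 * n ^ 2 := by
        calc 4 * 2 ^ (Nat.log 2 n + 1 + Nat.log 2 n) - 2
            ≤ 4 * 2 ^ (Nat.log 2 n + 1 + Nat.log 2 n) := Nat.sub_le _ _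
          _ = 2 * (2 ^ (Nat.log 2 n + 1)) ^ 2 := by ring
          _ ≤ 2 * (2 * n) ^ 2 := by gcongr
          _ = 8 * n ^ 2 := by ring
      calc ((4 * 2 ^ (Nat.log 2 n + 1 + Nat.log 2 n) - 2 : ℕ) : ℝ) ≤ 8 * (n : ℝ) ^ 2 := by
            exact_mod_cast hs
        _ ≤ 8 * (((2 * R + 2) * t) ^ d) ^ 2 := by gcongr; exact hnt (ht2 h)
        _ ≤ 8 * (2 ^ ((r + 1) ^ 2) * t ^ (d ^ 2)) := by
            gcongr
            exact GroupSort.grid_sq_le (ht2 h) (by positivity) hr hd'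
        _ = 8 * 2 ^ ((r + 1) ^ 2) * t ^ (d ^ 2) := by ring
        _ ≤ _ := by
            gcongr
            linarith [(by positivity : (0 : ℝ) ≤ 8 * 2 ^ r),
              (by positivity : (0 : ℝ) ≤ 2 * r + 5)]
    · have hu := fun i j => GroupSort.norm_interpolationSlope_le (hF f hf) (y i) (y j)
      obtain ⟨N, hN, hNe⟩ := GroupSort.exists_network_max_min hC _ _ hp hp
        (fun i j => GroupSort.interpolationSlope f (y i) (y j)) _ hu
        fun i j => hbias f hf _ (y i) (hu i j)
      exact ⟨N, hN, fun x =>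
        hmesh ▸ GroupSort.abs_sub_le_of_interpolation (hF f hf) hy (hNe x)⟩
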